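/- For $0\le p\le q$, $p+q<1$, the binary asymmetric channel $BAC(p,q)$ is the discrete memoryless channel on the alphabet $\mathbb F_2$ with $\Pr(1|0)=p$, $\Pr(0|0)=1-p$, $\Pr(0|1)=q$, $\Pr(1|1)=1-q$, where $\Pr(x|y)$ is the probability of receiving $x$ if $y$ was sent. For words $x,y\in\mathbb F_2^n$ put $\Pr_{(p,q)}(x|y)=\prod_{i=1}^n\Pr(x_i|y_i)$. Let $\mathcal T=\{(p,q)\in\mathbb R^2: 0\le p\le q,\ p+q<1\}\setminus\{(0,0)\}$, with the topology induced from $\mathbb R^2$. Two points $(p,q),(p',q')\in\mathcal T$ are called $n$-equivalent if maximum likelihood decoding agrees for all codes of length $n$, that is, if for every $C\subseteq\mathbb F_2^n$ and every $x\in\mathbb F_2^n$ the sets $\arg\max_{y\in C}\Pr_{(p,q)}(x|y)$ and $\arg\max_{y\in C}\Pr_{(p',q')}(x|y)$ of all maximizers are equal. A stable decision criterion for the $n$-fold BAC is an equivalence class of this relation on $\mathcal T$ which is an open subset of $\mathcal T$. Corollary (quadratic growth of the number of criteria). For every $n$ the number $t_n$ of stable decision criteria for the $n$-fold BAC is finite,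 and it grows quadratically with $n$ (that is, $t_n=\Theta(n^2)$ as $n\to\infty$). More explicitly, $$t_n=\frac{3}{2\pi^2}\,n^2+O(n\ln n)\qquad (n\to\infty).$$ -/

import Mathlib

open Filter Asymptotics

/-- A discrete memoryless channel with input and output alphabet `X`:
`W.prob x y` is the probability `Pr(x|y)` of receiving `x` if `y` was sent. -/
structure DMChannel (X : Type*) [Fintype X] where
  prob : X → X → ℝ
  prob_nonneg : ∀ x y, 0 ≤ prob x y
  prob_sum : ∀ y, ∑ x, prob x y = 1

/-- Transition probabilities of the `n`-fold channel: `Pr(x|y) = ∏ i, Pr(x i|y i)`. -/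
def DMChannel.foldProb {X : Type*} [Fintype X] (W : DMChannel X) {n : ℕ}
    (x y : Fin n → X) : ℝ :=
  ∏ i, W.prob (x i) (y i)

/-- The list of maximum likelihood decodings of the received word `x` in the code `C`:
all codewords `y ∈ C` that maximize `Pr(x|y)`. -/
def DMChannel.argMax {X : Type*} [Fintype X] (W : DMChannel X) {n : ℕ}
    (C : Set (Fin n → X)) (x : Fin n → X) : Set (Fin n → X) :=
  {y | y ∈ C ∧ ∀ z ∈ C, W.foldProb x z ≤ W.foldProb x y}

/-- Two channels are `n`-equivalent if they have the same maximum likelihood decoding for every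
code of block length `n` and every received word. -/
def DMChannel.NEquiv {X : Type*} [Fintype X] (n : ℕ) (W₁ W₂ : DMChannel X) : Prop :=
  ∀ (C : Set (Fin n → X)) (x : Fin n → X), W₁.argMax C x = W₂.argMax C x

/-- The parameter space `{(p, q) : 0 ≤ p ≤ q, p + q < 1} \ {(0, 0)}`. -/
def bacParams : Set (ℝ × ℝ) :=
  {θ | 0 ≤ θ.1 ∧ θ.1 ≤ θ.2 ∧ θ.1 + θ.2 < 1} \ {(0, 0)}

/-- The transition probabilities of `BAC(p, q)`: `Pr(1|0) = p`, `Pr(0|0) = 1 - p`,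
`Pr(0|1) = q`, `Pr(1|1) = 1 - q`. -/
def bacProb (p q : ℝ) (x y : ZMod 2) : ℝ :=
  if y = 0 then (if x = 1 then p else 1 - p) else (if x = 0 then q else 1 - q)

/-- The binary asymmetric channel `BAC(p, q)` with parameter `(p, q)` in the parameter space. -/
def bac (θ : bacParams) : DMChannel (ZMod 2) where
  prob := bacProb θ.1.1 θ.1.2
  prob_nonneg := by
    obtain ⟨⟨p, q⟩, ⟨h0, h1, h2⟩, -⟩ := θ
    intro x y
    simp only [bacProb] at *
    split_ifs <;> linarith
  prob_sum := by
    intro y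
    have h : ∀ f : ZMod 2 → ℝ, ∑ x, f x = f 0 + f 1 := fun f => Fin.sum_univ_two f
    rw [h]
    by_cases hy : y = 0 <;> simp [bacProb, hy]

/-- The relation of `n`-equivalence of binary asymmetric channels on the parameter space. -/
def bacSetoid (n : ℕ) : Setoid bacParams where
  r θ θ' := DMChannel.NEquiv n (bac θ) (bac θ')
  iseqv :=
    { refl := fun _ _ _ => rfl
      symm := fun h C x => (h C x).symm
      trans := fun h h' C x => (h C x).trans (h' C x) }

/-- The decision criteria of order `n` for the BAC: the classes of `n`-equivalence, as subsets of
the parameter space. -/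
def decisionCriteria (n : ℕ) : Set (Set bacParams) :=
  (bacSetoid n).classes

/-- The stable decision criteria: those that are open in the parameter space, which carries the
subspace topology of `ℝ × ℝ`. -/
def stableCriteria (n : ℕ) : Set (Set bacParams) :=
  {A | A ∈ decisionCriteria n ∧ IsOpen A}

/-! For `p > 0` the likelihood of `x` given `y` is a factor depending only on `x`, times a power of
`p / (1 - q)` for each sent 0 that flips and of `q / (1 - p)` for each sent 1 that flips. After
taking logarithms, comparing two codewords means comparing the slope `S` (`bacSlope`) with a ratio
`v / u`, where `u + v ≤ n`. Since `S ≥ 1`, only ratios `v / u ≥ 1` matter, so the class of a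
parameter is the position of `S` among the finitely many `criticalRatios` (`bac_nEquiv_iff_of_pos`).

The slope is continuous and attains every value in `[1, ∞)`, so each gap just above a critical ratio
is an open class. No other class is open: the slope can be raised locally, so a critical value of
`S` is unstable, and points with `p = 0` are limits of inequivalent points with `p > 0`. Hence, for
`n ≥ 2`, stable criteria correspond to critical ratios (`stableCriteria_eq_image`).

Critical ratios are reduced fractions, and counting them by `u + v` gives `2 t_n = ∑_{m ≤ n} φ(m)`.
The classical estimate `3 n² / π² + O(n log n)` of this sum finishes the proof. -/

/-! ### The summatory function of the totient. -/

open ArithmeticFunction in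
theorem totient_eq_sum_moebius_mul (n : ℕ) (hn : 0 < n) :
    ∑ x ∈ n.divisorsAntidiagonal, ((moebius x.1 : ℤ) : ℝ) * (x.2 : ℝ) = (n.totient : ℝ) := by
  refine (sum_eq_iff_sum_mul_moebius_eq (f := fun n => (n.totient : ℝ))
    (g := fun n => (n : ℝ))).1 (fun m _ => ?_) n hn
  exact_mod_cast Nat.sum_totient m

-- Insert `φ = μ * id` and sum over multiples of `d` first; the inner sum is a triangular number.
open ArithmeticFunction in
theorem sum_totient_Ioc (N : ℕ) :
    ∑ n ∈ Finset.Ioc 0 N, (n.totient : ℝ) =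
      ∑ d ∈ Finset.Ioc 0 N, ((moebius d : ℤ) : ℝ) * (((N / d : ℕ) : ℝ) * ((N / d : ℕ) + 1) / 2) := by
  have h := sum_Ioc_mul_eq_sum_sum ((moebius : ArithmeticFunction ℤ) : ArithmeticFunction ℝ)
    ((ArithmeticFunction.id : ArithmeticFunction ℕ) : ArithmeticFunction ℝ) N
  have gauss : ∀ M : ℕ, ∑ m ∈ Finset.Ioc 0 M, (m : ℝ) = (M : ℝ) * (M + 1) / 2 := by
    intro M
    induction M with
    | zero => simp
    | succ k ih => rw [Finset.sum_Ioc_succ_top (by omega), ih]; push_cast; ring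
  simp only [natCoe_apply, intCoe_apply, id_apply, gauss] at h
  rw [← h]
  refine Finset.sum_congr rfl fun n hn => ?_
  rw [mul_apply, ← totient_eq_sum_moebius_mul n (Finset.mem_Ioc.1 hn).1]
  simp

/-- With `t = N / d`, the bounds `t - 1 < ⌊t⌋ ≤ t` put the triangular number between `t (t - 1) / 2`
and `t (t + 1) / 2`. -/
theorem abs_floor_triangular_sub_le (N d : ℕ) (hd : 0 < d) (hdN : d ≤ N) :
    |((N / d : ℕ) : ℝ) * ((N / d : ℕ) + 1) / 2 - (N / d : ℝ) ^ 2 / 2| ≤ (N / d : ℝ) / 2 := by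
  have h1 : ((N / d : ℕ) : ℝ) ≤ (N / d : ℝ) := Nat.cast_div_le
  have h2 : (N / d : ℝ) < ((N / d : ℕ) : ℝ) + 1 := by
    rw [div_lt_iff₀ (by exact_mod_cast hd)]
    exact_mod_cast (Nat.div_lt_iff_lt_mul hd).1 (Nat.lt_succ_self (N / d))
  have h3 : (1 : ℝ) ≤ (N / d : ℝ) := by
    rw [le_div_iff₀ (by exact_mod_cast hd), one_mul]; exact_mod_cast hdN
  have h4 : (0 : ℝ) ≤ ((N / d : ℕ) : ℝ) := by positivity
  rw [abs_le]
  constructor <;> nlinarith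

open ArithmeticFunction in
theorem abs_moebius_cast_le_one (d : ℕ) : |((moebius d : ℤ) : ℝ)| ≤ 1 := by
  exact_mod_cast abs_moebius_le_one (n := d)

-- The sum is `1 / ζ(2)`, read off from the L-series of `μ` at 2.
open ArithmeticFunction in
theorem hasSum_moebius_div_sq :
    HasSum (fun d : ℕ => ((moebius d : ℤ) : ℝ) / (d : ℝ) ^ 2) (6 / Real.pi ^ 2) := by
  have hs : (1 : ℝ) < (2 : ℂ).re := by norm_num
  have h := (LSeriesSummable_moebius_iff.2 hs).LSeriesHasSum
  have hz := LSeries_zeta_mul_Lseries_moebius hs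
  rw [LSeries_zeta_eq_riemannZeta hs, riemannZeta_two] at hz
  have hval : LSeries (fun n => ((moebius n : ℤ) : ℂ)) 2 = ((6 / Real.pi ^ 2 : ℝ) : ℂ) := by
    have : (Real.pi : ℂ) ≠ 0 := by exact_mod_cast Real.pi_ne_zero
    push_cast
    rw [eq_div_iff (by positivity)]
    linear_combination 6 * hz
  rw [LSeriesHasSum, hval] at h
  rw [← Complex.hasSum_ofReal]
  convert h using 1
  ext d
  rcases eq_or_ne d 0 with rfl | hd
  · simp
  · rw [LSeries.term_of_ne_zero hd]
    push_cast
    congr 1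
    exact_mod_cast (Complex.cpow_natCast (d : ℂ) 2).symm

-- The tail is dominated by `∑ 1 / d²` over `(N, M]`, at most `1 / N - 1 / M`; then `M → ∞`.
open ArithmeticFunction in
theorem abs_sum_moebius_div_sq_sub_le (N : ℕ) (hN : 0 < N) :
    |∑ d ∈ Finset.Ioc 0 N, ((moebius d : ℤ) : ℝ) / (d : ℝ) ^ 2 - 6 / Real.pi ^ 2| ≤ 1 / (N : ℝ) := by
  have hlim := hasSum_moebius_div_sq.tendsto_sum_nat.comp (tendsto_add_atTop_nat 1)
  have hlim' := ((tendsto_const_nhds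
    (x := ∑ d ∈ Finset.Ioc 0 N, ((moebius d : ℤ) : ℝ) / (d : ℝ) ^ 2)).sub hlim).abs
  refine le_of_tendsto hlim' ((eventually_ge_atTop N).mono fun M hM => ?_)
  have hsplit : ∑ d ∈ Finset.range (M + 1), ((moebius d : ℤ) : ℝ) / (d : ℝ) ^ 2 =
      ∑ d ∈ Finset.Ioc 0 N, ((moebius d : ℤ) : ℝ) / (d : ℝ) ^ 2 +
        ∑ d ∈ Finset.Ioc N M, ((moebius d : ℤ) : ℝ) / (d : ℝ) ^ 2 := by
    rw [Finset.sum_Ioc_consecutive _ (Nat.zero_le N) hM]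
    refine (Finset.sum_subset (fun d hd => ?_) fun d hd hd' => ?_).symm
    · rw [Finset.mem_range]
      exact Nat.lt_succ_of_le (Finset.mem_Ioc.1 hd).2
    · rw [Finset.mem_range] at hd
      rw [Finset.mem_Ioc] at hd'
      obtain rfl : d = 0 := by omega
      simp
  simp only [Function.comp_apply]
  rw [hsplit, sub_add_cancel_left, abs_neg]
  calc _ ≤ ∑ d ∈ Finset.Ioc N M, |((moebius d : ℤ) : ℝ) / (d : ℝ) ^ 2| :=
        Finset.abs_sum_le_sum_abs _ _
    _ ≤ ∑ d ∈ Finset.Ioc N M, ((d : ℝ) ^ 2)⁻¹ := by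
        refine Finset.sum_le_sum fun d _ => ?_
        rw [abs_div, abs_of_nonneg (sq_nonneg (d : ℝ)), div_eq_mul_inv]
        exact mul_le_of_le_one_left (by positivity) (abs_moebius_cast_le_one d)
    _ ≤ (N : ℝ)⁻¹ - (M : ℝ)⁻¹ := sum_Ioc_inv_sq_le_sub hN.ne' hM
    _ ≤ 1 / (N : ℝ) := by rw [one_div]; linarith [inv_nonneg.2 (Nat.cast_nonneg (α := ℝ) M)]

-- Replacing the triangular numbers by `(N / d)² / 2` costs `N / 2` times a harmonic sum; completing
-- the Möbius series costs at most `N / 2`.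
open ArithmeticFunction in
theorem abs_sum_totient_sub_le (N : ℕ) (hN : 0 < N) :
    |∑ n ∈ Finset.Ioc 0 N, (n.totient : ℝ) - 3 / Real.pi ^ 2 * (N : ℝ) ^ 2| ≤
      (N : ℝ) + N * Real.log N := by
  have hN' : (0 : ℝ) < N := by exact_mod_cast hN
  have h1 : |∑ n ∈ Finset.Ioc 0 N, (n.totient : ℝ) -
      ∑ d ∈ Finset.Ioc 0 N, ((moebius d : ℤ) : ℝ) * ((N / d : ℝ) ^ 2 / 2)| ≤
        N / 2 * (1 + Real.log N) := by
    rw [sum_totient_Ioc, ← Finset.sum_sub_distrib]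
    calc _ ≤ _ := Finset.abs_sum_le_sum_abs _ _
      _ ≤ ∑ d ∈ Finset.Ioc 0 N, (N / 2 : ℝ) * ((d : ℝ))⁻¹ := by
          refine Finset.sum_le_sum fun d hd => ?_
          rw [← mul_sub, abs_mul]
          obtain ⟨hd0, hdN⟩ := Finset.mem_Ioc.1 hd
          calc _ ≤ 1 * ((N / d : ℝ) / 2) := mul_le_mul (abs_moebius_cast_le_one d)
                (abs_floor_triangular_sub_le N d hd0 hdN) (abs_nonneg _) zero_le_one
            _ = _ := by ring
      _ ≤ _ := by
          rw [← Finset.mul_sum]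
          have := harmonic_le_one_add_log N
          rw [harmonic_eq_sum_Icc] at this
          push_cast at this
          exact mul_le_mul_of_nonneg_left this (by positivity)
  have h2 := abs_sum_moebius_div_sq_sub_le N hN
  have h3 : ∑ d ∈ Finset.Ioc 0 N, ((moebius d : ℤ) : ℝ) * ((N / d : ℝ) ^ 2 / 2) =
      (N : ℝ) ^ 2 / 2 * ∑ d ∈ Finset.Ioc 0 N, ((moebius d : ℤ) : ℝ) / (d : ℝ) ^ 2 := by
    rw [Finset.mul_sum]
    exact Finset.sum_congr rfl fun d _ => by ring
  have h4 : |(N : ℝ) ^ 2 / 2 * (∑ d ∈ Finset.Ioc 0 N, ((moebius d : ℤ) : ℝ) / (d : ℝ) ^ 2 -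
      6 / Real.pi ^ 2)| ≤ (N : ℝ) / 2 := by
    rw [abs_mul, abs_of_nonneg (by positivity)]
    calc _ ≤ (N : ℝ) ^ 2 / 2 * (1 / N) := mul_le_mul_of_nonneg_left h2 (by positivity)
      _ = _ := by field_simp
  have hlog : 0 ≤ (N : ℝ) * Real.log N := mul_nonneg hN'.le (Real.log_natCast_nonneg N)
  rw [h3] at h1
  have h5 := abs_add_le _ _ |>.trans (add_le_add h1 h4)
  calc _ = _ := by congr 1; ring
    _ ≤ _ := h5
    _ ≤ _ := by linarith

/-! ### Counting critical ratios. -/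

/-- The pairs of coprime positive integers with sum at most `n`. -/
def coprimePairs (n : ℕ) : Finset (ℕ × ℕ) :=
  (Finset.range (n + 1) ×ˢ Finset.range (n + 1)).filter
    fun x => 0 < x.1 ∧ 0 < x.2 ∧ x.1 + x.2 ≤ n ∧ x.1.Coprime x.2

theorem mem_coprimePairs {n : ℕ} {x : ℕ × ℕ} :
    x ∈ coprimePairs n ↔ 0 < x.1 ∧ 0 < x.2 ∧ x.1 + x.2 ≤ n ∧ x.1.Coprime x.2 := by
  simp only [coprimePairs, Finset.mem_filter, Finset.mem_product, Finset.mem_range,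
    and_iff_right_iff_imp]
  omega

/-- On the fibre `u + v = m`, coprimality of `u` and `v` is coprimality of `u` and `m`. Positivity
of both entries excludes `m = 1`. -/
theorem card_coprimePairs (n : ℕ) :
    (coprimePairs n).card = ∑ m ∈ Finset.Ioc 1 n, m.totient := by
  rw [Finset.card_eq_sum_card_fiberwise (f := fun x => x.1 + x.2) (t := Finset.Ioc 1 n)]
  · refine Finset.sum_congr rfl fun m hm => ?_
    obtain ⟨hm1, hmn⟩ := Finset.mem_Ioc.1 hm
    rw [Nat.totient_eq_card_coprime]
    refine Finset.card_bij' (fun x _ => x.1) (fun u _ => (u, m - u)) ?_ ?_ ?_ ?_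
    · rintro ⟨u, v⟩ h
      simp only [Finset.mem_filter, mem_coprimePairs, Finset.mem_range] at h ⊢
      obtain ⟨⟨hu, hv, -, hc⟩, rfl⟩ := h
      exact ⟨by omega, (Nat.coprime_add_self_left.2 hc.symm : (v + u).Coprime u) |> (by
        rwa [Nat.add_comm] at ·)⟩
    · intro u h
      simp only [Finset.mem_filter, mem_coprimePairs, Finset.mem_range] at h ⊢
      have hu : u ≠ 0 := by
        rintro rfl
        have := (Nat.coprime_zero_right m).1 h.2
        omega
      refine ⟨⟨by omega, by omega, by omega, ?_⟩, by omega⟩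
      rw [Nat.coprime_sub_self_right h.1.le]
      exact h.2.symm
    · rintro ⟨u, v⟩ h
      simp only [Finset.mem_filter] at h
      simp only [Prod.mk.injEq, true_and]
      omega
    · intro u _
      rfl
  · intro x hx
    have := mem_coprimePairs.1 hx
    simp only [Finset.coe_Ioc, Set.mem_Ioc]
    omega

/-- By the swap symmetry, twice the half `u ≤ v` counts all pairs plus the diagonal. The only
diagonal pair is `(1, 1)`, and this extra 1 supplies the term `φ(1)`. -/
theorem two_mul_card_coprimePairs_le {n : ℕ} (hn : 2 ≤ n) :
    2 * ((coprimePairs n).filter fun x => x.1 ≤ x.2).card =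
      ∑ m ∈ Finset.Ioc 0 n, m.totient := by
  have hswap : ((coprimePairs n).filter fun x => x.1 ≤ x.2).card =
      ((coprimePairs n).filter fun x => x.2 ≤ x.1).card := by
    refine Finset.card_bij' (fun x _ => x.swap) (fun x _ => x.swap) ?_ ?_ ?_ ?_
    · intro x hx
      simp only [Finset.mem_filter, mem_coprimePairs, Prod.fst_swap, Prod.snd_swap] at hx ⊢
      exact ⟨⟨hx.1.2.1, hx.1.1, by omega, hx.1.2.2.2.symm⟩, hx.2⟩
    · intro x hx
      simp only [Finset.mem_filter, mem_coprimePairs, Prod.fst_swap, Prod.snd_swap] at hx ⊢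
      exact ⟨⟨hx.1.2.1, hx.1.1, by omega, hx.1.2.2.2.symm⟩, hx.2⟩
    · intro x _
      rfl
    · intro x _
      rfl
  have hunion : ((coprimePairs n).filter fun x => x.1 ≤ x.2) ∪
      ((coprimePairs n).filter fun x => x.2 ≤ x.1) = coprimePairs n := by
    rw [← Finset.filter_or]
    exact Finset.filter_true_of_mem fun x _ => le_total _ _
  have hinter : ((coprimePairs n).filter fun x => x.1 ≤ x.2) ∩
      ((coprimePairs n).filter fun x => x.2 ≤ x.1) = {(1, 1)} := by
    ext ⟨u, v⟩
    simp only [Finset.mem_inter, Finset.mem_filter, mem_coprimePairs, Finset.mem_singleton,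
      Prod.mk.injEq]
    constructor
    · rintro ⟨⟨⟨-, -, -, hc⟩, h1⟩, -, h2⟩
      obtain rfl : u = v := le_antisymm h1 h2
      rw [Nat.coprime_self] at hc
      exact ⟨hc, hc⟩
    · rintro ⟨rfl, rfl⟩
      simpa using hn
  have h := Finset.card_union_add_card_inter
    ((coprimePairs n).filter fun x => x.1 ≤ x.2) ((coprimePairs n).filter fun x => x.2 ≤ x.1)
  rw [hunion, hinter, ← hswap, card_coprimePairs, Finset.card_singleton] at h
  rw [← Finset.sum_Ioc_consecutive _ (Nat.zero_le 1) (by omega : 1 ≤ n)]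
  simp only [Nat.Ioc_succ_singleton, Finset.sum_singleton, zero_add, Nat.totient_one]
  omega

/-- The real numbers `v / u` with `1 ≤ u ≤ v` and `u + v ≤ n`. -/
noncomputable def criticalRatios (n : ℕ) : Finset ℝ :=
  ((coprimePairs n).filter fun x => x.1 ≤ x.2).image fun x => (x.2 : ℝ) / x.1

theorem card_criticalRatios (n : ℕ) :
    (criticalRatios n).card = ((coprimePairs n).filter fun x => x.1 ≤ x.2).card := by
  refine Finset.card_image_of_injOn ?_
  rintro ⟨u, v⟩ h ⟨u', v'⟩ h' he
  simp only [Finset.coe_filter, mem_coprimePairs, Set.mem_ofPred_eq] at h h' he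
  have hu : (u : ℝ) ≠ 0 := by exact_mod_cast h.1.1.ne'
  have hu' : (u' : ℝ) ≠ 0 := by exact_mod_cast h'.1.1.ne'
  rw [div_eq_div_iff hu hu'] at he
  have he' : v * u' = v' * u := by exact_mod_cast he
  have hd : u ∣ u' := h.1.2.2.2.dvd_of_dvd_mul_left ⟨v', by rw [he', mul_comm]⟩
  have hd' : u' ∣ u := h'.1.2.2.2.dvd_of_dvd_mul_left ⟨v, by rw [← he', mul_comm]⟩
  obtain rfl := Nat.dvd_antisymm hd hd'
  have := Nat.eq_of_mul_eq_mul_right h.1.1 he'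
  simp [this]

/-- Reduction to lowest terms does not increase `u + v`. -/
theorem div_mem_criticalRatios {n u v : ℕ} (hu : 0 < u) (huv : u ≤ v) (h : u + v ≤ n) :
    (v : ℝ) / u ∈ criticalRatios n := by
  obtain ⟨g, u', v', hg, hc, rfl, rfl⟩ := Nat.exists_coprime' (Nat.gcd_pos_of_pos_left v hu)
  have hu' : 0 < u' := Nat.pos_of_mul_pos_right hu
  have huv' : u' ≤ v' := Nat.le_of_mul_le_mul_right huv hg
  refine Finset.mem_image.2 ⟨(u', v'), ?_, ?_⟩
  · simp only [Finset.mem_filter, mem_coprimePairs]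
    exact ⟨⟨hu', hu'.trans_le huv', by nlinarith, hc⟩, huv'⟩
  · have : (g : ℝ) ≠ 0 := by exact_mod_cast hg.ne'
    push_cast
    rw [mul_div_mul_right _ _ this]

theorem exists_of_mem_criticalRatios {n : ℕ} {c : ℝ} (hc : c ∈ criticalRatios n) :
    ∃ u v : ℕ, 0 < u ∧ u ≤ v ∧ u + v ≤ n ∧ c = v / u := by
  obtain ⟨⟨u, v⟩, h, rfl⟩ := Finset.mem_image.1 hc
  simp only [Finset.mem_filter, mem_coprimePairs] at h
  exact ⟨u, v, h.1.1, h.2, h.1.2.2.1, rfl⟩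

theorem one_mem_criticalRatios {n : ℕ} (hn : 2 ≤ n) : (1 : ℝ) ∈ criticalRatios n := by
  simpa using div_mem_criticalRatios (u := 1) (v := 1) one_pos le_rfl hn

theorem one_le_of_mem_criticalRatios {n : ℕ} {c : ℝ} (hc : c ∈ criticalRatios n) : 1 ≤ c := by
  obtain ⟨u, v, hu, huv, -, rfl⟩ := exists_of_mem_criticalRatios hc
  rw [one_le_div (by exact_mod_cast hu)]
  exact_mod_cast huv

/-! ### Maximum likelihood decoding in terms of the slope. -/

/-- Codes with at most two words already determine the whole decoding rule. -/
theorem DMChannel.nEquiv_iff {X : Type*} [Fintype X] {n : ℕ} {W₁ W₂ : DMChannel X} :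
    DMChannel.NEquiv n W₁ W₂ ↔ ∀ x y z : Fin n → X,
      (W₁.foldProb x z ≤ W₁.foldProb x y ↔ W₂.foldProb x z ≤ W₂.foldProb x y) := by
  constructor
  · intro h x y z
    have key : ∀ W : DMChannel X,
        y ∈ W.argMax {y, z} x ↔ W.foldProb x z ≤ W.foldProb x y := by
      intro W
      simp [DMChannel.argMax]
    rw [← key, ← key, h]
  · intro h C x
    ext y
    simp only [DMChannel.argMax, Set.mem_ofPred_eq, h]

/-- The number of positions at which a `0` of `y` is received as a `1` of `x`. -/
def zeroFlips {n : ℕ} (x y : Fin n → ZMod 2) : ℕ :=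
  (Finset.univ.filter fun i => x i = 1 ∧ y i = 0).card

/-- The number of positions at which a `1` of `y` is received as a `0` of `x`. -/
def oneFlips {n : ℕ} (x y : Fin n → ZMod 2) : ℕ :=
  (Finset.univ.filter fun i => x i = 0 ∧ y i = 1).card

/-- The two counts live on disjoint sets of positions, the ones and the zeros of `x`. This is the
source of the constraint `u + v ≤ n`. -/
theorem zeroFlips_add_oneFlips_le {n : ℕ} (x y z : Fin n → ZMod 2) :
    zeroFlips x y + oneFlips x z ≤ n := by
  rw [zeroFlips, oneFlips, ← Finset.card_union_of_disjoint]
  · exact (Finset.card_le_univ _).trans_eq (Fintype.card_fin n)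
  · rw [Finset.disjoint_filter]
    rintro i - ⟨h, -⟩ ⟨h', -⟩
    rw [h] at h'
    exact one_ne_zero h'

/-- The ratio `Pr(1|0) / Pr(1|1)` of `BAC(p, q)`. -/
noncomputable def zeroRatio (θ : bacParams) : ℝ := θ.1.1 / (1 - θ.1.2)

/-- The ratio `Pr(0|1) / Pr(0|0)` of `BAC(p, q)`. -/
noncomputable def oneRatio (θ : bacParams) : ℝ := θ.1.2 / (1 - θ.1.1)

/-- The BAC-function `log (p / (1 - q)) / log (q / (1 - p))`. -/
noncomputable def bacSlope (θ : bacParams) : ℝ :=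
  Real.log (zeroRatio θ) / Real.log (oneRatio θ)

section Params

variable (θ : bacParams)

theorem bacParams_fst_nonneg : 0 ≤ θ.1.1 := θ.2.1.1

theorem bacParams_fst_le_snd : θ.1.1 ≤ θ.1.2 := θ.2.1.2.1

theorem bacParams_add_lt_one : θ.1.1 + θ.1.2 < 1 := θ.2.1.2.2

theorem bacParams_snd_pos : 0 < θ.1.2 := by
  obtain ⟨⟨p, q⟩, ⟨h0, h1, h2⟩, h3⟩ := θ
  refine lt_of_le_of_ne (h0.trans h1) fun h => h3 ?_
  simp only at *
  have hq : q = 0 := h.symm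
  have hp : p = 0 := by linarith
  simp [hp, hq]

theorem bacParams_one_sub_fst_pos : 0 < 1 - θ.1.1 := by
  linarith [bacParams_add_lt_one θ, bacParams_snd_pos θ]

theorem bacParams_one_sub_snd_pos : 0 < 1 - θ.1.2 := by
  linarith [bacParams_add_lt_one θ, bacParams_fst_nonneg θ]

theorem oneRatio_pos : 0 < oneRatio θ :=
  div_pos (bacParams_snd_pos θ) (bacParams_one_sub_fst_pos θ)

theorem oneRatio_lt_one : oneRatio θ < 1 := by
  rw [oneRatio, div_lt_one (bacParams_one_sub_fst_pos θ)]
  linarith [bacParams_add_lt_one θ]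

theorem zeroRatio_le_oneRatio : zeroRatio θ ≤ oneRatio θ := by
  rw [zeroRatio, oneRatio,
    div_le_div_iff₀ (bacParams_one_sub_snd_pos θ) (bacParams_one_sub_fst_pos θ)]
  nlinarith [bacParams_add_lt_one θ, bacParams_fst_le_snd θ]

theorem log_oneRatio_neg : Real.log (oneRatio θ) < 0 :=
  Real.log_neg (oneRatio_pos θ) (oneRatio_lt_one θ)

variable {θ}

theorem zeroRatio_pos (hp : 0 < θ.1.1) : 0 < zeroRatio θ :=
  div_pos hp (bacParams_one_sub_snd_pos θ)

theorem one_le_bacSlope (hp : 0 < θ.1.1) : 1 ≤ bacSlope θ := by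
  rw [bacSlope, one_le_div_of_neg (log_oneRatio_neg θ)]
  exact Real.log_le_log (zeroRatio_pos hp) (zeroRatio_le_oneRatio θ)

end Params

/-- The product in front is the likelihood for `y = x`; each flip multiplies it by one of the two
ratios. It cancels whenever two codewords are compared for the same `x`. -/
theorem bac_foldProb_eq (θ : bacParams) {n : ℕ} (x y : Fin n → ZMod 2) :
    (bac θ).foldProb x y = (∏ i, if x i = 1 then 1 - θ.1.2 else 1 - θ.1.1) *
      (zeroRatio θ ^ zeroFlips x y * oneRatio θ ^ oneFlips x y) := by
  have hp := (bacParams_one_sub_fst_pos θ).ne'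
  have hq := (bacParams_one_sub_snd_pos θ).ne'
  have hpow : ∀ (c : ℝ) (P : Fin n → Prop) [DecidablePred P],
      c ^ (Finset.univ.filter P).card = ∏ i, if P i then c else 1 := by
    intro c P _
    rw [Finset.prod_ite, Finset.prod_const, Finset.prod_const_one, mul_one]
  rw [zeroFlips, oneFlips, hpow, hpow, ← Finset.prod_mul_distrib, ← Finset.prod_mul_distrib,
    DMChannel.foldProb]
  refine Finset.prod_congr rfl fun i _ => ?_
  have hcases : ∀ a : ZMod 2, a = 0 ∨ a = 1 := by decide
  rcases hcases (x i) with hx | hx <;> rcases hcases (y i) with hy | hy <;>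
    simp [bac, bacProb, hx, hy, zeroRatio, oneRatio] <;> field_simp

theorem bac_foldProb_le_iff_of_pos {θ : bacParams} (hp : 0 < θ.1.1) {n : ℕ}
    (x y z : Fin n → ZMod 2) :
    (bac θ).foldProb x z ≤ (bac θ).foldProb x y ↔
      zeroFlips x y * bacSlope θ + oneFlips x y ≤ zeroFlips x z * bacSlope θ + oneFlips x z := by
  have hC : 0 < ∏ i, if x i = 1 then 1 - θ.1.2 else 1 - θ.1.1 := by
    refine Finset.prod_pos fun i _ => ?_
    split_ifs
    exacts [bacParams_one_sub_snd_pos θ, bacParams_one_sub_fst_pos θ]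
  have h0 := zeroRatio_pos hp
  have h1 := oneRatio_pos θ
  have hlog := log_oneRatio_neg θ
  have hS : Real.log (zeroRatio θ) = bacSlope θ * Real.log (oneRatio θ) :=
    (div_mul_cancel₀ _ hlog.ne).symm
  have hexp : ∀ a b : ℕ, Real.log (zeroRatio θ ^ a * oneRatio θ ^ b) =
      (a * bacSlope θ + b) * Real.log (oneRatio θ) := by
    intro a b
    rw [Real.log_mul (pow_pos h0 a).ne' (pow_pos h1 b).ne', Real.log_pow, Real.log_pow, hS]
    ring
  rw [bac_foldProb_eq, bac_foldProb_eq, mul_le_mul_iff_right₀ hC,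
    ← Real.log_le_log_iff (mul_pos (pow_pos h0 _) (pow_pos h1 _))
      (mul_pos (pow_pos h0 _) (pow_pos h1 _)), hexp, hexp, mul_le_mul_right_of_neg hlog]

theorem card_filter_fin_val_lt {n u : ℕ} (h : u ≤ n) :
    (Finset.univ.filter fun i : Fin n => (i : ℕ) < u).card = u := by
  rw [Fin.card_filter_val_lt, min_eq_right h]

theorem exists_flips {n u v : ℕ} (h : u + v ≤ n) : ∃ x y z : Fin n → ZMod 2,
    zeroFlips x y = u ∧ oneFlips x y = 0 ∧ zeroFlips x z = 0 ∧ oneFlips x z = v := by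
  refine ⟨fun i => if (i : ℕ) < u then 1 else 0, fun _ => 0,
    fun i => if (i : ℕ) < u + v then 1 else 0, ?_, ?_, ?_, ?_⟩
  · simp [zeroFlips, card_filter_fin_val_lt (show u ≤ n by omega)]
  · simp [oneFlips]
  · simp only [zeroFlips, ite_eq_left_iff, ite_eq_right_iff, zero_ne_one, one_ne_zero, imp_false,
      not_not, Finset.card_eq_zero, Finset.filter_eq_empty_iff]
    intro i _
    omega
  · have hs := Finset.card_sdiff_of_subset
      (s := Finset.univ.filter fun i : Fin n => (i : ℕ) < u)
      (t := Finset.univ.filter fun i : Fin n => (i : ℕ) < u + v)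
      (fun i hi => by simp only [Finset.mem_filter] at hi ⊢; exact ⟨hi.1, by omega⟩)
    rw [card_filter_fin_val_lt h, card_filter_fin_val_lt (by omega), Nat.add_sub_cancel_left] at hs
    refine Eq.trans (congrArg Finset.card ?_) hs
    ext i
    simp only [Finset.mem_filter, Finset.mem_sdiff, Finset.mem_univ, true_and, ite_eq_left_iff,
      ite_eq_right_iff, zero_ne_one, one_ne_zero, imp_false, not_not]
    tauto

/-- `exists_flips` realizes every critical ratio as the threshold of some comparison. Conversely,
differences of flip counts yield only thresholds `v / u` with `u + v ≤ n`, and those below 1 never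
separate slopes. -/
theorem bac_nEquiv_iff_of_pos {n : ℕ} {θ θ' : bacParams} (hp : 0 < θ.1.1) (hp' : 0 < θ'.1.1) :
    DMChannel.NEquiv n (bac θ) (bac θ') ↔ ∀ c ∈ criticalRatios n,
      (c ≤ bacSlope θ ↔ c ≤ bacSlope θ') ∧ (bacSlope θ ≤ c ↔ bacSlope θ' ≤ c) := by
  rw [DMChannel.nEquiv_iff]
  simp only [bac_foldProb_le_iff_of_pos hp, bac_foldProb_le_iff_of_pos hp']
  have hS := one_le_bacSlope hp
  have hS' := one_le_bacSlope hp'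
  constructor
  · intro h c hc
    obtain ⟨u, v, hu, -, huv, rfl⟩ := exists_of_mem_criticalRatios hc
    obtain ⟨x, y, z, h1, h2, h3, h4⟩ := exists_flips huv
    have hu' : (0 : ℝ) < u := by exact_mod_cast hu
    have hyz := h x y z
    have hzy := h x z y
    simp only [h1, h2, h3, h4, Nat.cast_zero, add_zero, zero_mul, zero_add] at hyz hzy
    rw [div_le_iff₀' hu', div_le_iff₀' hu', le_div_iff₀' hu', le_div_iff₀' hu']
    exact ⟨hzy, hyz⟩
  · intro h x y z
    have key : ∀ u v : ℕ, 0 < u → u + v ≤ n →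
        ((v : ℝ) ≤ u * bacSlope θ ↔ (v : ℝ) ≤ u * bacSlope θ') ∧
          (u * bacSlope θ ≤ v ↔ u * bacSlope θ' ≤ v) := by
      intro u v hu huv
      have hu' : (0 : ℝ) < u := by exact_mod_cast hu
      rcases le_or_gt u v with hle | hlt
      · have := h _ (div_mem_criticalRatios hu hle huv)
        rwa [div_le_iff₀' hu', div_le_iff₀' hu', le_div_iff₀' hu', le_div_iff₀' hu'] at this
      · have hlt' : (v : ℝ) < u := by exact_mod_cast hlt
        have h1 : (v : ℝ) < u * bacSlope θ := by nlinarith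
        have h2 : (v : ℝ) < u * bacSlope θ' := by nlinarith
        exact ⟨iff_of_true h1.le h2.le, iff_of_false h1.not_ge h2.not_ge⟩
    have b1 := zeroFlips_add_oneFlips_le x y z
    have b2 := zeroFlips_add_oneFlips_le x z y
    generalize zeroFlips x y = a at *
    generalize zeroFlips x z = a' at *
    generalize oneFlips x y = b at *
    generalize oneFlips x z = b' at *
    rcases lt_trichotomy a a' with haa | rfl | haa
    · obtain ⟨d, rfl⟩ := Nat.exists_eq_add_of_lt haa
      rcases le_total b b' with hbb | hbb
      · have : (b : ℝ) ≤ b' := by exact_mod_cast hbb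
        push_cast
        refine iff_of_true ?_ ?_ <;> nlinarith [Nat.cast_nonneg (α := ℝ) d]
      · obtain ⟨e, rfl⟩ := Nat.exists_eq_add_of_le hbb
        have := (key (d + 1) e (by omega) (by omega)).1
        push_cast at this ⊢
        constructor <;> intro h'
        · linarith [this.1 (by linarith)]
        · linarith [this.2 (by linarith)]
    · simp
    · obtain ⟨d, rfl⟩ := Nat.exists_eq_add_of_lt haa
      rcases le_total b' b with hbb | hbb
      · have : (b' : ℝ) ≤ b := by exact_mod_cast hbb
        push_cast
        refine iff_of_false ?_ ?_ <;> rw [not_le] <;> nlinarith [Nat.cast_nonneg (α := ℝ) d]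
      · obtain ⟨e, rfl⟩ := Nat.exists_eq_add_of_le hbb
        have := (key (d + 1) e (by omega) (by omega)).2
        push_cast at this ⊢
        constructor <;> intro h'
        · linarith [this.1 (by linarith)]
        · linarith [this.2 (by linarith)]

/-- For `x` all ones, compare sent words with `n` zeros and with a single zero. At `p = 0` both
likelihoods vanish and tie; for `p > 0` the word with more flips is strictly worse. -/
theorem bac_not_nEquiv_of_fst_eq_zero {n : ℕ} (hn : 2 ≤ n) {θ θ' : bacParams} (hp : θ.1.1 = 0)
    (hp' : 0 < θ'.1.1) : ¬ DMChannel.NEquiv n (bac θ) (bac θ') := by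
  rw [DMChannel.nEquiv_iff]
  intro h
  have hn' : 0 < n := by omega
  let x : Fin n → ZMod 2 := fun _ => 1
  let y : Fin n → ZMod 2 := fun _ => 0
  let z : Fin n → ZMod 2 := fun i => if (i : ℕ) < 1 then 0 else 1
  have hy : zeroFlips x y = n := by simp [zeroFlips, x, y]
  have hz : zeroFlips x z = 1 := by
    rw [← card_filter_fin_val_lt (show 1 ≤ n by omega), zeroFlips]
    congr 1
    ext i
    simp [x, z]
  have hoy : oneFlips x y = 0 := by simp [oneFlips, x]
  have hoz : oneFlips x z = 0 := by simp [oneFlips, x]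
  have hle : (bac θ).foldProb x z ≤ (bac θ).foldProb x y := by
    rw [bac_foldProb_eq, bac_foldProb_eq, hy, hz]
    simp [zeroRatio, hp, hn'.ne']
  rw [h, bac_foldProb_le_iff_of_pos hp', hy, hz, hoy, hoz] at hle
  have : (2 : ℝ) ≤ n := by exact_mod_cast hn
  push_cast at hle
  nlinarith [one_le_bacSlope hp']

/-! ### Range, continuity and local variation of the slope. -/

theorem exists_bacSlope_eq {s : ℝ} (hs : 1 ≤ s) :
    ∃ θ : bacParams, 0 < θ.1.1 ∧ bacSlope θ = s := by
  -- The witness below solves `q / (1 - p) = 1 / 2` and `p / (1 - q) = 1 / r`.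
  obtain ⟨r, hr⟩ : ∃ r : ℝ, r = 2 ^ s := ⟨_, rfl⟩
  have hr2 : 2 ≤ r := by
    rw [hr]
    calc (2 : ℝ) = 2 ^ (1 : ℝ) := (Real.rpow_one 2).symm
      _ ≤ 2 ^ s := Real.rpow_le_rpow_of_exponent_le one_le_two hs
  have hd : 0 < 2 * r - 1 := by linarith
  have hp : 0 < 1 / (2 * r - 1) := one_div_pos.2 hd
  refine ⟨⟨(1 / (2 * r - 1), (r - 1) / (2 * r - 1)), ⟨hp.le, ?_, ?_⟩, ?_⟩, hp, ?_⟩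
  · exact div_le_div_of_nonneg_right (by linarith) hd.le
  · simp only
    rw [← add_div, div_lt_one hd]
    linarith
  · intro h
    exact hp.ne' (congrArg Prod.fst (Set.mem_singleton_iff.1 h))
  · have h0 : 1 / (2 * r - 1) / (1 - (r - 1) / (2 * r - 1)) = r⁻¹ := by
      rw [one_sub_div hd.ne', div_div_div_cancel_right₀ hd.ne', one_div]
      congr 1
      ring
    have h1 : (r - 1) / (2 * r - 1) / (1 - 1 / (2 * r - 1)) = 2⁻¹ := by
      rw [one_sub_div hd.ne', div_div_div_cancel_right₀ hd.ne',
        div_eq_iff (by linarith : 2 * r - 1 - 1 ≠ 0)]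
      ring
    have hlog : Real.log 2 ≠ 0 := (Real.log_pos one_lt_two).ne'
    simp only [bacSlope, zeroRatio, oneRatio, h0, h1, Real.log_inv, neg_div_neg_eq]
    rw [hr, Real.log_rpow two_pos, mul_div_cancel_right₀ _ hlog]

theorem continuousOn_bacSlope : ContinuousOn bacSlope {θ | 0 < θ.1.1} := by
  have h1 : Continuous fun θ : bacParams => θ.1.1 := by fun_prop
  have h2 : Continuous fun θ : bacParams => θ.1.2 := by fun_prop
  refine ContinuousOn.div (ContinuousOn.log ?_ fun θ hθ => (zeroRatio_pos hθ).ne')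
    (ContinuousOn.log ?_ fun θ _ => (oneRatio_pos θ).ne') fun θ _ => (log_oneRatio_neg θ).ne
  · exact (h1.div (continuous_const.sub h2)
      fun θ => (bacParams_one_sub_snd_pos θ).ne').continuousOn
  · exact (h2.div (continuous_const.sub h1)
      fun θ => (bacParams_one_sub_fst_pos θ).ne').continuousOn

theorem exists_mem_fst_pos_of_isOpen {U : Set bacParams} (hU : IsOpen U) {θ : bacParams}
    (hθ : θ ∈ U) (hp : θ.1.1 = 0) : ∃ θ' ∈ U, 0 < θ'.1.1 := by
  obtain ⟨V, hV, rfl⟩ := isOpen_induced_iff.1 hU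
  have hq := bacParams_snd_pos θ
  have hq' := bacParams_one_sub_snd_pos θ
  have hf : ContinuousAt (fun t : ℝ => (t, θ.1.2)) 0 := by fun_prop
  have hmem : ∀ᶠ t in nhdsWithin (0 : ℝ) (Set.Ioi 0), (t, θ.1.2) ∈ V :=
    nhdsWithin_le_nhds (hf.eventually (hV.mem_nhds (by rw [← hp]; exact hθ)))
  obtain ⟨t, ht, ht0, ht1⟩ :=
    (hmem.and (Ioo_mem_nhdsGT (lt_min hq hq'))).exists
  rw [lt_min_iff] at ht1
  refine ⟨⟨(t, θ.1.2), ⟨ht0.le, ht1.1.le, ?_⟩, fun h => ht0.ne' (congrArg Prod.fst (Set.mem_singleton_iff.1 h))⟩, ht, ht0⟩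
  simp only
  linarith [ht1.2]

/-- Along the curve `q = (1 - t) * oneRatio θ` the ratio `oneRatio` stays constant, while decreasing
`t` lowers `zeroRatio` and so raises the slope. -/
theorem exists_mem_bacSlope_lt_of_isOpen {U : Set bacParams} (hU : IsOpen U) {θ : bacParams}
    (hθ : θ ∈ U) (hp : 0 < θ.1.1) : ∃ θ' ∈ U, 0 < θ'.1.1 ∧ bacSlope θ < bacSlope θ' := by
  obtain ⟨V, hV, rfl⟩ := isOpen_induced_iff.1 hU
  have hρ := oneRatio_pos θ
  have hρ' := oneRatio_lt_one θ
  have hlog := log_oneRatio_neg θ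
  have hqρ : (1 - θ.1.1) * oneRatio θ = θ.1.2 :=
    mul_div_cancel₀ _ (bacParams_one_sub_fst_pos θ).ne'
  have h1p := bacParams_one_sub_fst_pos θ
  have hf : ContinuousAt (fun t : ℝ => (t, (1 - t) * oneRatio θ)) θ.1.1 := by fun_prop
  have hmem : ∀ᶠ t in nhdsWithin θ.1.1 (Set.Iio θ.1.1), (t, (1 - t) * oneRatio θ) ∈ V :=
    nhdsWithin_le_nhds (hf.eventually (hV.mem_nhds (by beta_reduce; rw [hqρ]; exact hθ)))
  obtain ⟨t, ht, ht0, htp⟩ := (hmem.and (Ioo_mem_nhdsLT hp)).exists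
  have hle := bacParams_fst_le_snd θ
  refine ⟨⟨(t, (1 - t) * oneRatio θ), ⟨ht0.le, ?_, ?_⟩,
    fun h => ht0.ne' (congrArg Prod.fst (Set.mem_singleton_iff.1 h))⟩, ht, ht0, ?_⟩
  · simp only
    nlinarith
  · simp only
    nlinarith
  · have h1t : 0 < 1 - t := by linarith
    have hone : (1 - t) * oneRatio θ / (1 - t) = oneRatio θ := mul_div_cancel_left₀ _ h1t.ne'
    have hden : 0 < 1 - (1 - t) * oneRatio θ := by nlinarith
    have hzero : t / (1 - (1 - t) * oneRatio θ) < zeroRatio θ := by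
      rw [zeroRatio, div_lt_div_iff₀ hden (bacParams_one_sub_snd_pos θ), ← hqρ]
      nlinarith
    have := Real.log_lt_log (div_pos ht0 hden) hzero
    change Real.log (zeroRatio θ) / Real.log (oneRatio θ) <
      Real.log (t / (1 - (1 - t) * oneRatio θ)) / Real.log ((1 - t) * oneRatio θ / (1 - t))
    rwa [hone, div_lt_div_right_of_neg hlog]

/-! ### Stable criteria as gaps between critical ratios. -/

/-- The parameters whose slope lies strictly between `c` and the next critical ratio. -/
def bacCell (n : ℕ) (c : ℝ) : Set bacParams :=
  {θ | 0 < θ.1.1 ∧ c < bacSlope θ ∧ ∀ d ∈ criticalRatios n, c < d → bacSlope θ < d}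

theorem isOpen_bacCell (n : ℕ) (c : ℝ) : IsOpen (bacCell n c) := by
  have hpos : IsOpen {θ : bacParams | 0 < θ.1.1} :=
    isOpen_lt continuous_const (by fun_prop)
  have hI : IsOpen (Set.Ioi c ∩ ⋂ d ∈ (criticalRatios n).filter (c < ·), Set.Iio d) :=
    isOpen_Ioi.inter (isOpen_biInter_finset fun d _ => isOpen_Iio)
  convert continuousOn_bacSlope.isOpen_inter_preimage hpos hI using 1
  ext θ
  simp [bacCell]

theorem bacCell_nonempty {n : ℕ} {c : ℝ} (hc : c ∈ criticalRatios n) :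
    (bacCell n c).Nonempty := by
  have h : ∀ᶠ s in nhdsWithin c (Set.Ioi c), ∀ d ∈ (criticalRatios n).filter (c < ·), s < d :=
    (Finset.eventually_all _).2 fun d hd =>
      nhdsWithin_le_nhds (eventually_lt_nhds (Finset.mem_filter.1 hd).2)
  obtain ⟨s, hs, hcs⟩ := (h.and self_mem_nhdsWithin).exists
  have hcs' : c < s := hcs
  obtain ⟨θ, hp, rfl⟩ := exists_bacSlope_eq ((one_le_of_mem_criticalRatios hc).trans hcs'.le)
  exact ⟨θ, hp, hcs', fun d hd hcd => hs d (Finset.mem_filter.2 ⟨hd, hcd⟩)⟩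

theorem eq_of_mem_bacCell {n : ℕ} {c d : ℝ} {θ : bacParams} (hc : c ∈ criticalRatios n)
    (hd : d ∈ criticalRatios n) (hθc : θ ∈ bacCell n c) (hθd : θ ∈ bacCell n d) : c = d := by
  rcases lt_trichotomy c d with h | h | h
  · exact absurd (hθc.2.2 d hd h) hθd.2.1.not_gt
  · exact h
  · exact absurd (hθd.2.2 c hc h) hθc.2.1.not_gt

theorem nEquiv_class_eq_bacCell {n : ℕ} (hn : 2 ≤ n) {c : ℝ} (hc : c ∈ criticalRatios n)
    {θ : bacParams} (hθ : θ ∈ bacCell n c) : {θ' | (bacSetoid n).r θ' θ} = bacCell n c := by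
  ext θ'
  change DMChannel.NEquiv n (bac θ') (bac θ) ↔ _
  rcases (bacParams_fst_nonneg θ').eq_or_lt with hp' | hp'
  · exact iff_of_false (bac_not_nEquiv_of_fst_eq_zero hn hp'.symm hθ.1) fun h => hp'.not_lt h.1
  rw [bac_nEquiv_iff_of_pos hp' hθ.1]
  constructor
  · intro h
    refine ⟨hp', ?_, fun d hd hcd => ?_⟩
    · rw [← not_le, (h c hc).2, not_le]
      exact hθ.2.1
    · rw [← not_le, (h d hd).1, not_le]
      exact hθ.2.2 d hd hcd
  · intro hθ' d hd
    rcases le_or_gt d c with h | h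
    · have h1 := h.trans_lt hθ.2.1
      have h2 := h.trans_lt hθ'.2.1
      exact ⟨iff_of_true h2.le h1.le, iff_of_false h2.not_ge h1.not_ge⟩
    · have h1 := hθ.2.2 d hd h
      have h2 := hθ'.2.2 d hd h
      exact ⟨iff_of_false h2.not_ge h1.not_ge, iff_of_true h2.le h1.le⟩

/-- An open class contains neither a point with `p = 0` nor one with critical slope, so it is the
cell above the largest critical ratio below its slope. That ratio exists because 1 is critical and
slopes are at least 1. -/
theorem stableCriteria_eq_image {n : ℕ} (hn : 2 ≤ n) :
    stableCriteria n = bacCell n '' (criticalRatios n : Set ℝ) := by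
  ext A
  constructor
  · rintro ⟨⟨θ, rfl⟩, hopen⟩
    have hθ : θ ∈ {θ' | (bacSetoid n).r θ' θ} := (bacSetoid n).refl θ
    rcases (bacParams_fst_nonneg θ).eq_or_lt with hp | hp
    · obtain ⟨θ', hθ', hp'⟩ := exists_mem_fst_pos_of_isOpen hopen hθ hp.symm
      exact absurd ((bacSetoid n).symm hθ') (bac_not_nEquiv_of_fst_eq_zero hn hp.symm hp')
    have hS : bacSlope θ ∉ criticalRatios n := by
      intro hS
      obtain ⟨θ', hθ', hp', hlt⟩ := exists_mem_bacSlope_lt_of_isOpen hopen hθ hp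
      have := ((bac_nEquiv_iff_of_pos hp' hp).1 hθ' _ hS).2.2 le_rfl
      exact hlt.not_ge this
    obtain ⟨c, hc, hmax⟩ := ((criticalRatios n).filter (· ≤ bacSlope θ)).exists_max_image id
      ⟨1, Finset.mem_filter.2 ⟨one_mem_criticalRatios hn, one_le_bacSlope hp⟩⟩
    obtain ⟨hcK, hcS⟩ := Finset.mem_filter.1 hc
    refine ⟨c, hcK, (nEquiv_class_eq_bacCell hn hcK ⟨hp, ?_, fun d hd hcd => ?_⟩).symm⟩
    · exact lt_of_le_of_ne hcS fun h => hS (h ▸ hcK)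
    · by_contra hle
      exact hcd.not_ge (hmax d (Finset.mem_filter.2 ⟨hd, not_lt.1 hle⟩))
  · rintro ⟨c, hc, rfl⟩
    obtain ⟨θ, hθ⟩ := bacCell_nonempty hc
    exact ⟨⟨θ, (nEquiv_class_eq_bacCell hn hc hθ).symm⟩, isOpen_bacCell n c⟩

theorem ncard_stableCriteria {n : ℕ} (hn : 2 ≤ n) :
    2 * (stableCriteria n).ncard = ∑ m ∈ Finset.Ioc 0 n, m.totient := by
  rw [stableCriteria_eq_image hn, Set.InjOn.ncard_image, Set.ncard_coe_finset,
    card_criticalRatios, two_mul_card_coprimePairs_le hn]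
  intro c hc d hd h
  obtain ⟨θ, hθ⟩ := bacCell_nonempty hc
  exact eq_of_mem_bacCell hc hd hθ (h ▸ hθ)

/-- Classes are fibres of the map from a parameter to its decoding rule, and there are finitely many
rules. -/
theorem finite_decisionCriteria (n : ℕ) : (decisionCriteria n).Finite := by
  let F : bacParams → Set (Fin n → ZMod 2) → (Fin n → ZMod 2) → Set (Fin n → ZMod 2) :=
    fun θ => (bac θ).argMax
  have h : decisionCriteria n ⊆ (fun a => F ⁻¹' {a}) '' Set.univ := by
    rintro A ⟨θ, rfl⟩
    refine ⟨F θ, trivial, ?_⟩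
    ext θ'
    exact ⟨fun h C x => congrFun (congrFun h C) x, fun h => funext fun C => funext (h C)⟩
  exact (Set.finite_univ.image _).subset h

theorem stableCriteria_finite (n : ℕ) : (stableCriteria n).Finite :=
  (finite_decisionCriteria n).subset fun _ h => h.1

/-! ### Asymptotics of the number of stable criteria. -/

theorem ncard_stableCriteria_sub_isBigO :
    (fun n : ℕ => ((stableCriteria n).ncard : ℝ) - 3 / (2 * Real.pi ^ 2) * (n : ℝ) ^ 2)
      =O[atTop] fun n : ℕ => (n : ℝ) * Real.log n := by
  -- For `n ≥ 3`, `log n ≥ 1` absorbs the linear term: twice the error is at most `n + n log n ≤ 2 n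
  -- log n`.
  refine IsBigO.of_bound 1 ((eventually_ge_atTop 3).mono fun n hn => ?_)
  have h2 : (2 : ℝ) * (stableCriteria n).ncard = ∑ m ∈ Finset.Ioc 0 n, (m.totient : ℝ) := by
    exact_mod_cast ncard_stableCriteria (by omega : 2 ≤ n)
  have h := abs_sum_totient_sub_le n (by omega)
  have hlog : 1 ≤ Real.log n := by
    rw [Real.le_log_iff_exp_le (by positivity)]
    have : (3 : ℝ) ≤ n := by exact_mod_cast hn
    linarith [Real.exp_one_lt_d9]
  have hn0 : (0 : ℝ) ≤ n := by positivity
  rw [← h2, show 2 * ((stableCriteria n).ncard : ℝ) - 3 / Real.pi ^ 2 * (n : ℝ) ^ 2 =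
    2 * (((stableCriteria n).ncard : ℝ) - 3 / (2 * Real.pi ^ 2) * (n : ℝ) ^ 2) by
      field_simp, abs_mul, abs_of_pos (two_pos : (0 : ℝ) < 2)] at h
  rw [Real.norm_eq_abs, Real.norm_eq_abs, one_mul, abs_of_nonneg (a := (n : ℝ) * _)
    (by positivity)]
  nlinarith

theorem natCast_mul_log_isLittleO_sq :
    (fun n : ℕ => (n : ℝ) * Real.log n) =o[atTop] fun n : ℕ => (n : ℝ) ^ 2 := by
  have h : (fun n : ℕ => Real.log n) =o[atTop] fun n : ℕ => (n : ℝ) :=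
    Real.isLittleO_log_id_atTop.comp_tendsto tendsto_natCast_atTop_atTop
  simpa only [sq] using (isBigO_refl (fun n : ℕ => (n : ℝ)) atTop).mul_isLittleO h

theorem ncard_stableCriteria_isTheta :
    (fun n : ℕ => ((stableCriteria n).ncard : ℝ)) =Θ[atTop] fun n : ℕ => (n : ℝ) ^ 2 := by
  have hc : (3 / (2 * Real.pi ^ 2) : ℝ) ≠ 0 := by positivity
  have h1 : (fun n : ℕ => 3 / (2 * Real.pi ^ 2) * (n : ℝ) ^ 2) =Θ[atTop]
      fun n : ℕ => (n : ℝ) ^ 2 := (isTheta_const_mul_left hc).2 (isTheta_refl _ _)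
  have h2 := ncard_stableCriteria_sub_isBigO.trans_isLittleO natCast_mul_log_isLittleO_sq
  have h3 := (h2.trans_isTheta h1.symm).right_isTheta_add
  refine EventuallyEq.trans_isTheta (Eventually.of_forall fun n => ?_) (h3.symm.trans h1)
  simp

theorem mainTheorem4 :
    (∀ n : ℕ, (stableCriteria n).Finite) ∧
    ((fun n : ℕ => ((stableCriteria n).ncard : ℝ)) =Θ[atTop] fun n : ℕ => (n : ℝ) ^ 2) ∧
    ((fun n : ℕ => ((stableCriteria n).ncard : ℝ) - 3 / (2 * Real.pi ^ 2) * (n : ℝ) ^ 2)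
      =O[atTop] fun n : ℕ => (n : ℝ) * Real.log n) :=
  ⟨stableCriteria_finite, ncard_stableCriteria_isTheta, ncard_stableCriteria_sub_isBigO⟩
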